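/- Let $E=(E^0,E^1,r,s)$ be an arbitrary directed graph and $K$ an arbitrary field. Let $L=L_K(E)$ be the Leavitt path algebra, i.e. the (not necessarily unital) associative $K$-algebra generated by pairwise orthogonal idempotents $v$ ($v\in E^0$) and elements $e,e^*$ ($e\in E^1$) subject to: $s(e)e=e=e\,r(e)$ and $r(e)e^*=e^*=e^*s(e)$ for all $e\in E^1$; $e^*e=r(e)$ for all $e\in E^1$ and $e^*f=0$ for $e\neq f$ in $E^1$; and $v=\sum_{s(e)=v}ee^*$ for every vertex $v$ with $0<|s^{-1}(v)|<\infty$. Let $A=\mathrm{End}(L_L)$ be the unital ring of endomorphisms of $L$ as a right $L$-module, with composition $(fg)(x)=f(g(x))$ as multiplication. Then $A$ is left and right non-singular: its left singular ideal $\{x\in A : \{a\in A: ax=0\}\text{ is an essential left ideal of }A\}$ and its right singular ideal $\{x\in A : \{a\in A: xa=0\}\text{ is an essential right ideal of }A\}$ are both zero. -/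

import Mathlib

universe u v w

/-- A directed graph `(E⁰, E¹, r, s)`, with vertex set `V` and edge set `E`
(both of arbitrary cardinality). -/
structure DirectedGraph (V : Type u) (E : Type v) where
  /-- The source of an edge. -/
  s : E → V
  /-- The range of an edge. -/
  r : E → V

namespace LeavittPath

variable {V : Type u} {E : Type v}

/-- The generating symbols: vertices `v`, edges `e`, ghost edges `e*`. -/
inductive Gen (V : Type u) (E : Type v) : Type (max u v)
  | vertex (x : V) : Gen V E
  | edge (e : E) : Gen V E
  | ghost (e : E) : Gen V E

/-- A vertex as an element of the free algebra. -/
noncomputable def fv (K : Type w) [Field K] (E : Type v) (x : V) : FreeAlgebra K (Gen V E) :=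
  FreeAlgebra.ι K (Gen.vertex x)

/-- An edge as an element of the free algebra. -/
noncomputable def fe (K : Type w) [Field K] (V : Type u) (e : E) : FreeAlgebra K (Gen V E) :=
  FreeAlgebra.ι K (Gen.edge e)

/-- A ghost edge as an element of the free algebra. -/
noncomputable def fg (K : Type w) [Field K] (V : Type u) (e : E) : FreeAlgebra K (Gen V E) :=
  FreeAlgebra.ι K (Gen.ghost e)

/-- The defining relations of the Leavitt path algebra. In `ck2` the vertex `x` is regular:
it emits at least one and only finitely many edges. -/
inductive Rel (K : Type w) [Field K] (G : DirectedGraph V E) :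
    FreeAlgebra K (Gen V E) → FreeAlgebra K (Gen V E) → Prop
  | vertex_idem (x : V) : Rel K G (fv K E x * fv K E x) (fv K E x)
  | vertex_orth (x y : V) (h : x ≠ y) : Rel K G (fv K E x * fv K E y) 0
  | source_edge (e : E) : Rel K G (fv K E (G.s e) * fe K V e) (fe K V e)
  | edge_range (e : E) : Rel K G (fe K V e * fv K E (G.r e)) (fe K V e)
  | range_ghost (e : E) : Rel K G (fv K E (G.r e) * fg K V e) (fg K V e)
  | ghost_source (e : E) : Rel K G (fg K V e * fv K E (G.s e)) (fg K V e)
  | ck1_same (e : E) : Rel K G (fg K V e * fe K V e) (fv K E (G.r e))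
  | ck1_ne (e f : E) (h : e ≠ f) : Rel K G (fg K V e * fe K V f) 0
  | ck2 (x : V) (hne : (G.s ⁻¹' {x}).Nonempty) (hfin : (G.s ⁻¹' {x}).Finite) :
      Rel K G (fv K E x) (∑ e ∈ hfin.toFinset, fe K V e * fg K V e)

/-- The free unital `K`-algebra on the generators modulo the relations. As no relation involves
the unit, this is the Leavitt path algebra with a unit freely adjoined. -/
abbrev UnitalAlgebra (K : Type w) [Field K] (G : DirectedGraph V E) : Type (max u v w) :=
  RingQuot (Rel K G)

/-- The generators inside `UnitalAlgebra K G`. -/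
noncomputable def gen (K : Type w) [Field K] (G : DirectedGraph V E) (a : Gen V E) :
    UnitalAlgebra K G :=
  RingQuot.mkAlgHom K (Rel K G) (FreeAlgebra.ι K a)

end LeavittPath

/-- The Leavitt path algebra `L_K(E)` of an arbitrary graph: the (in general non-unital)
`K`-algebra generated by the vertices, edges and ghost edges subject to the defining relations.
It is realised as the non-unital `K`-subalgebra that they generate in the unital algebra with the
same presentation. -/
noncomputable def LeavittPathAlgebra (K : Type w) [Field K] {V : Type u} {E : Type v}
    (G : DirectedGraph V E) : NonUnitalSubalgebra K (LeavittPath.UnitalAlgebra K G) :=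
  NonUnitalAlgebra.adjoin K (Set.range (LeavittPath.gen K G))

/-- For a ring `L`, possibly without unit, the unital ring `End(L_L)` of endomorphisms of `L` as a
right `L`-module: the additive maps with `f (x y) = f x y`, multiplied by composition
`(f g) x = f (g x)`. -/
def rightModuleEnd (L : Type u) [NonUnitalRing L] : Subring (AddMonoid.End L) where
  carrier := {f | ∀ x y : L, f (x * y) = f x * y}
  one_mem' := fun _ _ => rfl
  zero_mem' := fun x y => by
    change (0 : L) = 0 * y
    rw [zero_mul]
  mul_mem' := fun {f g} hf hg x y => by
    change f (g (x * y)) = f (g x) * y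
    rw [hg, hf]
  add_mem' := fun {f g} hf hg x y => by
    change f (x * y) + g (x * y) = (f x + g x) * y
    rw [hf, hg, add_mul]
  neg_mem' := fun {f} hf x y => by
    change -(f (x * y)) = -(f x) * y
    rw [hf, neg_mul]

/-- A submodule is essential if it meets every non-zero submodule non-trivially. -/
def IsEssentialSubmodule {R : Type u} {M : Type v} [Ring R] [AddCommGroup M] [Module R M]
    (N : Submodule R M) : Prop :=
  ∀ P : Submodule R M, P ≠ ⊥ → N ⊓ P ≠ ⊥

/-- The annihilator `{a | a • m = 0}` of an element, a left ideal. -/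
def elementAnnihilator (R : Type u) {M : Type v} [Ring R] [AddCommGroup M] [Module R M] (m : M) :
    Submodule R R :=
  LinearMap.ker (LinearMap.toSpanSingleton R M m)

theorem mem_elementAnnihilator {R : Type u} {M : Type v} [Ring R] [AddCommGroup M] [Module R M]
    {m : M} {a : R} : a ∈ elementAnnihilator R m ↔ a • m = 0 := by
  simp [elementAnnihilator]

/-- The singular submodule `Z(M)` of a (left) module: the elements whose annihilator is an
essential left ideal. -/
def singularSubmodule (R : Type u) (M : Type v) [Ring R] [AddCommGroup M] [Module R M] :
    Submodule R M where
  carrier := {m | IsEssentialSubmodule (elementAnnihilator R m)}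
  zero_mem' := by
    intro P hP h
    refine hP ((Submodule.eq_bot_iff _).2 fun p hp => ?_)
    refine (Submodule.eq_bot_iff _).1 h p ⟨mem_elementAnnihilator.2 (smul_zero _), hp⟩
  add_mem' := by
    intro m n hm hn P hP h
    refine hn _ (hm P hP) ((Submodule.eq_bot_iff _).2 fun p hp => ?_)
    refine (Submodule.eq_bot_iff _).1 h p ⟨mem_elementAnnihilator.2 ?_, hp.2.2⟩
    rw [smul_add, mem_elementAnnihilator.1 hp.1, mem_elementAnnihilator.1 hp.2.1, add_zero]
  smul_mem' := by
    intro r m hm P hP h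
    have key : ∀ p ∈ P, (p * r) • m = 0 → p = 0 := fun p hp h0 =>
      (Submodule.eq_bot_iff _).1 h p
        ⟨mem_elementAnnihilator.2 (by rw [smul_smul]; simpa using h0), hp⟩
    refine hm (P.map (LinearMap.toSpanSingleton R R r)) ?_ ((Submodule.eq_bot_iff _).2 ?_)
    · intro h0
      refine hP ((Submodule.eq_bot_iff _).2 fun p hp => key p hp ?_)
      have h1 : p * r = 0 := by
        simpa using (Submodule.eq_bot_iff _).1 h0 _ (Submodule.mem_map_of_mem hp)
      simp [h1]
    · rintro x ⟨hx, p, hp, rfl⟩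
      have h1 := mem_elementAnnihilator.1 hx
      have h2 : p = 0 := key p hp (by simpa using h1)
      simp [h2]

/-- The left singular ideal of a ring `A`: the `x` for which `{a | a x = 0}` is an essential left
ideal. -/
def leftSingularIdeal (A : Type u) [Ring A] : Submodule A A :=
  singularSubmodule A A

/-- The right singular ideal of a ring `A`: the `x` for which `{a | x a = 0}` is an essential right
ideal. Right `A`-modules are `Aᵐᵒᵖ`-modules, with `MulOpposite.op a • x = x * a`. -/
def rightSingularIdeal (A : Type u) [Ring A] : Submodule Aᵐᵒᵖ A :=
  singularSubmodule Aᵐᵒᵖ A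

/-- A ring is left non-singular if its left singular ideal is zero. -/
def IsLeftNonsingular (A : Type u) [Ring A] : Prop :=
  leftSingularIdeal A = ⊥

/-- A ring is right non-singular if its right singular ideal is zero. -/
def IsRightNonsingular (A : Type u) [Ring A] : Prop :=
  rightSingularIdeal A = ⊥

/-! Call a combination of paths, with no ghost edges, a path polynomial. Any non-zero `a` in `L`
becomes a non-zero path polynomial `a * p` after right multiplication by a suitable path `p`
(`exists_mul_pathMon_mem_realSpan`). Path polynomials meeting at a vertex multiply without
cancellation, because paths are linearly independent and the longest terms survive
(`realSpan_mul_ne_zero`). Hence `a * p * b = 0` forces `p * b = 0`: otherwise `r(p) * b ≠ 0` could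
itself be turned into a non-zero path polynomial on the right (`exists_left_injective`). The
involution gives the mirror statement.

These cancellation properties pass to `A`. If `x ≠ 0` in `A`, choose `z` with `x z ≠ 0` and a
suitable `p` for the element `x z` of `L`. Write `λ_q` for left multiplication by `q`. The non-zero
left ideal `A λ_p`, respectively the non-zero right ideal `λ_{zp} A`, meets the annihilator of `x`
trivially, so that annihilator is not essential. Local units in `L` relate endomorphisms to
multiplications. -/

namespace LeavittPath

/-! ### Relations, universal property and involution -/

section Presentation

variable {V : Type u} {E : Type v} {K : Type w} [Field K] {G : DirectedGraph V E}

variable (K G) in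
/-- A vertex in the Leavitt path algebra. -/
noncomputable def vtx (x : V) : UnitalAlgebra K G := gen K G (.vertex x)

variable (K G) in
/-- An edge in the Leavitt path algebra. -/
noncomputable def edg (e : E) : UnitalAlgebra K G := gen K G (.edge e)

variable (K G) in
/-- A ghost edge in the Leavitt path algebra. -/
noncomputable def gho (e : E) : UnitalAlgebra K G := gen K G (.ghost e)

theorem vtx_mul_self (x : V) : vtx K G x * vtx K G x = vtx K G x := by
  simpa [fv, vtx, gen] using RingQuot.mkAlgHom_rel K (Rel.vertex_idem (K := K) (G := G) x)

theorem vtx_mul_ne {x y : V} (h : x ≠ y) : vtx K G x * vtx K G y = 0 := by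
  simpa [fv, vtx, gen] using RingQuot.mkAlgHom_rel K (Rel.vertex_orth (K := K) (G := G) x y h)

theorem source_mul_edg (e : E) : vtx K G (G.s e) * edg K G e = edg K G e := by
  simpa [fv, fe, vtx, edg, gen] using RingQuot.mkAlgHom_rel K (Rel.source_edge (K := K) (G := G) e)

theorem edg_mul_range (e : E) : edg K G e * vtx K G (G.r e) = edg K G e := by
  simpa [fv, fe, vtx, edg, gen] using RingQuot.mkAlgHom_rel K (Rel.edge_range (K := K) (G := G) e)

theorem range_mul_gho (e : E) : vtx K G (G.r e) * gho K G e = gho K G e := by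
  simpa [fv, fg, vtx, gho, gen] using RingQuot.mkAlgHom_rel K (Rel.range_ghost (K := K) (G := G) e)

theorem gho_mul_source (e : E) : gho K G e * vtx K G (G.s e) = gho K G e := by
  simpa [fv, fg, vtx, gho, gen] using
    RingQuot.mkAlgHom_rel K (Rel.ghost_source (K := K) (G := G) e)

theorem gho_mul_edg (e : E) : gho K G e * edg K G e = vtx K G (G.r e) := by
  simpa [fv, fe, fg, vtx, edg, gho, gen] using
    RingQuot.mkAlgHom_rel K (Rel.ck1_same (K := K) (G := G) e)

theorem gho_mul_edg_ne {e f : E} (h : e ≠ f) : gho K G e * edg K G f = 0 := by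
  simpa [fv, fe, fg, vtx, edg, gho, gen] using
    RingQuot.mkAlgHom_rel K (Rel.ck1_ne (K := K) (G := G) e f h)

theorem vtx_eq_sum (x : V) (hne : (G.s ⁻¹' {x}).Nonempty) (hfin : (G.s ⁻¹' {x}).Finite) :
    vtx K G x = ∑ e ∈ hfin.toFinset, edg K G e * gho K G e := by
  simpa [fv, fe, fg, vtx, edg, gho, gen] using
    RingQuot.mkAlgHom_rel K (Rel.ck2 (K := K) (G := G) x hne hfin)

theorem gho_mul_vtx_ne {e : E} {x : V} (h : x ≠ G.s e) : gho K G e * vtx K G x = 0 := by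
  rw [← gho_mul_source, mul_assoc, vtx_mul_ne h.symm, mul_zero]

/-- The universal property of the presentation. -/
theorem exists_lift {A : Type*} [Ring A] [Algebra K A] (f : Gen V E → A)
    (vertex_idem : ∀ x, f (.vertex x) * f (.vertex x) = f (.vertex x))
    (vertex_orth : ∀ x y, x ≠ y → f (.vertex x) * f (.vertex y) = 0)
    (source_edge : ∀ e, f (.vertex (G.s e)) * f (.edge e) = f (.edge e))
    (edge_range : ∀ e, f (.edge e) * f (.vertex (G.r e)) = f (.edge e))
    (range_ghost : ∀ e, f (.vertex (G.r e)) * f (.ghost e) = f (.ghost e))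
    (ghost_source : ∀ e, f (.ghost e) * f (.vertex (G.s e)) = f (.ghost e))
    (ck1_same : ∀ e, f (.ghost e) * f (.edge e) = f (.vertex (G.r e)))
    (ck1_ne : ∀ e e', e ≠ e' → f (.ghost e) * f (.edge e') = 0)
    (ck2 : ∀ x, (G.s ⁻¹' {x}).Nonempty → ∀ hfin : (G.s ⁻¹' {x}).Finite,
      f (.vertex x) = ∑ e ∈ hfin.toFinset, f (.edge e) * f (.ghost e)) :
    ∃ φ : UnitalAlgebra K G →ₐ[K] A, ∀ a, φ (gen K G a) = f a := by
  refine ⟨RingQuot.liftAlgHom K ⟨FreeAlgebra.lift K f, ?_⟩, fun a => ?_⟩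
  · intro a b hab
    cases hab with
    | vertex_idem x => simpa [fv] using vertex_idem x
    | vertex_orth x y h => simpa [fv] using vertex_orth x y h
    | source_edge e => simpa [fv, fe] using source_edge e
    | edge_range e => simpa [fv, fe] using edge_range e
    | range_ghost e => simpa [fv, fg] using range_ghost e
    | ghost_source e => simpa [fv, fg] using ghost_source e
    | ck1_same e => simpa [fv, fe, fg] using ck1_same e
    | ck1_ne e e' h => simpa [fv, fe, fg] using ck1_ne e e' h
    | ck2 x hne hfin => simpa [fv, fe, fg] using ck2 x hne hfin
  · simp [gen]

/-- The canonical involution, fixing the vertices and exchanging edges and ghost edges. -/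
theorem exists_involution : ∃ φ : UnitalAlgebra K G →ₐ[K] (UnitalAlgebra K G)ᵐᵒᵖ,
    (∀ x, (φ (φ x).unop).unop = x) ∧
      ∀ x ∈ LeavittPathAlgebra K G, (φ x).unop ∈ LeavittPathAlgebra K G := by
  let f : Gen V E → Gen V E := fun
    | .vertex x => .vertex x
    | .edge e => .ghost e
    | .ghost e => .edge e
  obtain ⟨φ, hφ⟩ := exists_lift (K := K) (G := G) (fun a => MulOpposite.op (gen K G (f a)))
    (fun x => congrArg MulOpposite.op (vtx_mul_self x))
    (fun x y h => congrArg MulOpposite.op (vtx_mul_ne h.symm))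
    (fun e => congrArg MulOpposite.op (gho_mul_source e))
    (fun e => congrArg MulOpposite.op (range_mul_gho e))
    (fun e => congrArg MulOpposite.op (edg_mul_range e))
    (fun e => congrArg MulOpposite.op (source_mul_edg e))
    (fun e => congrArg MulOpposite.op (gho_mul_edg e))
    (fun e e' h => congrArg MulOpposite.op (gho_mul_edg_ne h.symm))
    (fun x hne hfin => (congrArg MulOpposite.op (vtx_eq_sum x hne hfin)).trans
      (map_sum MulOpposite.opAddEquiv _ _))
  have hff : ∀ a, f (f a) = a := by rintro (_ | _ | _) <;> rfl
  -- The square of the anti-automorphism is an algebra endomorphism, so it is the identity once it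
  -- fixes the generators.
  let ψ : UnitalAlgebra K G →ₐ[K] UnitalAlgebra K G :=
    { toFun := fun x => (φ (φ x).unop).unop
      map_one' := by simp
      map_zero' := by simp
      map_mul' := by simp
      map_add' := by simp
      commutes' := by simp }
  have hψ : ψ = AlgHom.id K _ := by
    refine RingQuot.ringQuot_ext' K _ _ (FreeAlgebra.hom_ext (funext fun a => ?_))
    change (φ (φ (gen K G a)).unop).unop = gen K G a
    simp [hφ, hff]
  refine ⟨φ, fun x => DFunLike.congr_fun hψ x, fun x hx => ?_⟩
  refine NonUnitalAlgebra.adjoin_induction (p := fun x _ => (φ x).unop ∈ LeavittPathAlgebra K G)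
    ?_ ?_ ?_ ?_ ?_ hx
  · rintro _ ⟨a, rfl⟩
    rw [hφ]
    exact NonUnitalAlgebra.subset_adjoin K ⟨f a, rfl⟩
  · intro x y _ _ hx hy
    simpa using add_mem hx hy
  · simp
  · intro x y _ _ hx hy
    simpa using mul_mem hy hx
  · intro k x _ hx
    simpa using SMulMemClass.smul_mem k hx

end Presentation

/-! ### A graded branching representation -/

section Representation

variable {V : Type u} {E : Type v}

/-- Injections `σ e` of an infinite set whose images partition it along each set of edges with
common source. -/
theorem exists_branching (s : E → V) : ∃ σ : E → ℕ ⊕ E → ℕ ⊕ E,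
    (∀ e f b c, s e = s f → σ e b = σ f c → e = f ∧ b = c) ∧
      ∀ e b, ∃ f c, s f = s e ∧ σ f c = b := by
  have key : ∀ x : V, ∃ φ : (s ⁻¹' {x} : Set E) × (ℕ ⊕ E) → ℕ ⊕ E, Function.Injective φ ∧
      (Nonempty (s ⁻¹' {x} : Set E) → Function.Surjective φ) := by
    intro x
    by_cases h : Nonempty (s ⁻¹' {x} : Set E)
    · have hc : Cardinal.mk ((s ⁻¹' {x} : Set E) × (ℕ ⊕ E)) = Cardinal.mk (ℕ ⊕ E) := by
        rw [Cardinal.mk_prod, Cardinal.lift_id, Cardinal.lift_id]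
        refine Cardinal.mul_eq_right (Cardinal.aleph0_le_mk _) ?_ (Cardinal.mk_ne_zero _)
        exact Cardinal.mk_le_of_injective (f := fun e => Sum.inr e.1)
          fun a b hab => Subtype.ext (Sum.inr_injective hab)
      obtain ⟨φ⟩ := Cardinal.eq.1 hc
      exact ⟨φ, φ.injective, fun _ => φ.surjective⟩
    · exact ⟨fun p => p.2, fun p => (h ⟨p.1⟩).elim, fun h' => (h h').elim⟩
  choose φ hinj hsurj using key
  refine ⟨fun e b => φ (s e) (⟨e, rfl⟩, b), fun e f b c h h' => ?_, fun e b => ?_⟩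
  · have aux : ∀ x (h1 : s e = x) (h2 : s f = x), φ x (⟨e, h1⟩, b) = φ x (⟨f, h2⟩, c) →
        e = f ∧ b = c := fun x h1 h2 h3 => by
      simpa [Prod.ext_iff, Subtype.ext_iff] using hinj x h3
    refine aux (s e) rfl h.symm (h'.trans ?_)
    have aux' : ∀ x (h1 : s f = x), φ (s f) (⟨f, rfl⟩, c) = φ x (⟨f, h1⟩, c) := by
      rintro _ rfl; rfl
    exact aux' _ _
  · obtain ⟨⟨⟨f, hf⟩, c⟩, hp⟩ := hsurj (s e) ⟨⟨e, rfl⟩⟩ b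
    refine ⟨f, c, hf, ?_⟩
    have aux' : ∀ x (h1 : s f = x), φ (s f) (⟨f, rfl⟩, c) = φ x (⟨f, h1⟩, c) := by
      rintro _ rfl; rfl
    exact (aux' _ hf).trans hp

open Classical in
/-- A representation in which paths move a graded basis injectively. -/
theorem exists_representation (K : Type w) [Field K] (G : DirectedGraph V E) :
    ∃ (σ : E → ℕ ⊕ E → ℕ ⊕ E)
      (ρ : UnitalAlgebra K G →ₐ[K] Module.End K ((V × (ℕ ⊕ E) × ℤ) →₀ K)),
      (∀ e f b c, G.s e = G.s f → σ e b = σ f c → e = f ∧ b = c) ∧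
      (∀ x y b n, ρ (vtx K G x) (Finsupp.single (y, b, n) 1) =
        if y = x then Finsupp.single (y, b, n) 1 else 0) ∧
      ∀ e b n, ρ (edg K G e) (Finsupp.single (G.r e, b, n) 1) =
        Finsupp.single (G.s e, σ e b, n + 1) 1 := by
  obtain ⟨σ, hinj, hsurj⟩ := exists_branching G.s
  let op (p : V × (ℕ ⊕ E) × ℤ → (V × (ℕ ⊕ E) × ℤ) →₀ K) :
    Module.End K ((V × (ℕ ⊕ E) × ℤ) →₀ K) := Finsupp.linearCombination K p
  have hop : ∀ p x, op p (Finsupp.single x 1) = p x := fun p x => by simp [op]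
  let f : Gen V E → Module.End K ((V × (ℕ ⊕ E) × ℤ) →₀ K) := fun
    | .vertex x => op fun p => if p.1 = x then Finsupp.single p 1 else 0
    | .edge e => op fun p =>
        if p.1 = G.r e then Finsupp.single (G.s e, σ e p.2.1, p.2.2 + 1) 1 else 0
    | .ghost e => op fun p =>
        if h : p.1 = G.s e ∧ ∃ c, σ e c = p.2.1 then
          Finsupp.single (G.r e, h.2.choose, p.2.2 - 1) 1 else 0
  have hv : ∀ x y b n, f (.vertex x) (Finsupp.single (y, b, n) 1) =
      if y = x then Finsupp.single (y, b, n) 1 else 0 := fun x y b n => hop _ _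
  have he : ∀ e y b n, f (.edge e) (Finsupp.single (y, b, n) 1) =
      if y = G.r e then Finsupp.single (G.s e, σ e b, n + 1) 1 else 0 := fun e y b n => hop _ _
  have hg : ∀ e b n, f (.ghost e) (Finsupp.single (G.s e, σ e b, n) 1) =
      Finsupp.single (G.r e, b, n - 1) 1 := by
    intro e b n
    have h : ∃ c, σ e c = σ e b := ⟨b, rfl⟩
    refine (hop _ _).trans ((dif_pos ⟨rfl, h⟩).trans ?_)
    -- The chosen preimage is `b` since `σ e` is injective.
    rw [(hinj e e _ _ rfl h.choose_spec).2]
  have hg0 : ∀ e y b n, ¬ (y = G.s e ∧ ∃ c, σ e c = b) →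
      f (.ghost e) (Finsupp.single (y, b, n) 1) = 0 := fun e y b n h =>
    (hop _ _).trans (dif_neg h)
  have ext1 : ∀ S T : Module.End K ((V × (ℕ ⊕ E) × ℤ) →₀ K),
      (∀ y b n, S (Finsupp.single (y, b, n) 1) = T (Finsupp.single (y, b, n) 1)) → S = T := by
    intro S T h
    refine Finsupp.lhom_ext' fun p => LinearMap.ext_ring ?_
    exact h p.1 p.2.1 p.2.2
  obtain ⟨ρ, hρ⟩ := exists_lift (K := K) (G := G) f
    (fun x => ext1 _ _ fun y b n => by
      rw [Module.End.mul_apply, hv]; split_ifs with h <;> simp [hv, h])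
    (fun x z hxz => ext1 _ _ fun y b n => by
      rw [Module.End.mul_apply, hv]
      split_ifs with h
      · simp [hv, h, hxz.symm]
      · simp)
    (fun e => ext1 _ _ fun y b n => by
      rw [Module.End.mul_apply, he]; split_ifs with h <;> simp [hv])
    (fun e => ext1 _ _ fun y b n => by
      rw [Module.End.mul_apply, hv, he]; split_ifs with h <;> simp [he, h])
    (fun e => ext1 _ _ fun y b n => by
      rw [Module.End.mul_apply]
      by_cases h : y = G.s e ∧ ∃ c, σ e c = b
      · obtain ⟨rfl, c, rfl⟩ := h
        simp [hg, hv]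
      · simp [hg0 _ _ _ _ h])
    (fun e => ext1 _ _ fun y b n => by
      rw [Module.End.mul_apply, hv]
      split_ifs with h
      · rfl
      · rw [hg0 _ _ _ _ fun h' => h h'.1, map_zero])
    (fun e => ext1 _ _ fun y b n => by
      rw [Module.End.mul_apply, he, hv]
      split_ifs with h
      · rw [hg, h, add_sub_cancel_right]
      · simp)
    (fun e e' hne => ext1 _ _ fun y b n => by
      rw [Module.End.mul_apply, he]
      split_ifs with h
      · rw [hg0, LinearMap.zero_apply]
        rintro ⟨h1, c, h2⟩
        exact hne (hinj _ _ _ _ h1.symm h2).1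
      · simp)
    (fun x hne hfin => ext1 _ _ fun y b n => by
      rw [hv, LinearMap.sum_apply]
      split_ifs with h
      · subst h
        obtain ⟨e, hes⟩ := hne
        -- The images of the `σ e` with source `y` cover the index set disjointly, so exactly one
        -- summand `e e*` acts as the identity on this basis vector and the others kill it.
        obtain ⟨e, c, hes', rfl⟩ := hsurj e b
        have hes' : G.s e = y := hes'.trans hes
        subst hes'
        rw [Finset.sum_eq_single e]
        · rw [Module.End.mul_apply, hg, he, if_pos rfl, sub_add_cancel]
        · intro e' _ hne
          rw [Module.End.mul_apply, hg0, map_zero]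
          rintro ⟨h1, c', h2⟩
          exact hne (hinj _ _ _ _ h1.symm h2).1
        · intro h'
          exact (h' (by simp)).elim
      · refine (Finset.sum_eq_zero fun e hes => ?_).symm
        rw [Module.End.mul_apply, hg0, map_zero]
        rintro ⟨h1, -⟩
        exact h (h1.trans (by simpa using hes)))
  refine ⟨σ, ρ, hinj, fun x y b n => ?_, fun e b n => ?_⟩
  · rw [vtx, hρ, hv]
  · rw [edg, hρ, he, if_pos rfl]

end Representation

/-! ### Linear independence of paths and products of path polynomials -/

section Paths

variable {V : Type u} {E : Type v} {K : Type w} [Field K] {G : DirectedGraph V E}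

/-- The source of the path with edge list `l` and range `x`. -/
def pathSource (G : DirectedGraph V E) (x : V) : List E → V
  | [] => x
  | e :: _ => G.s e

/-- A list of edges is a path with range `x`. -/
def IsPath (G : DirectedGraph V E) (x : V) : List E → Prop
  | [] => True
  | e :: l => G.r e = pathSource G x l ∧ IsPath G x l

variable (K G) in
/-- The monomial of the path with edge list `l` and range `x`. -/
noncomputable def pathMon (x : V) : List E → UnitalAlgebra K G
  | [] => vtx K G x
  | e :: l => edg K G e * pathMon x l

theorem source_mul_pathMon (x : V) (l : List E) :
    vtx K G (pathSource G x l) * pathMon K G x l = pathMon K G x l := by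
  cases l with
  | nil => exact vtx_mul_self x
  | cons e l => simp only [pathSource, pathMon]; rw [← mul_assoc, source_mul_edg]

theorem vtx_mul_pathMon_ne {x y : V} {l : List E} (h : y ≠ pathSource G x l) :
    vtx K G y * pathMon K G x l = 0 := by
  rw [← source_mul_pathMon, ← mul_assoc, vtx_mul_ne h, zero_mul]

theorem pathMon_mul_range (x : V) (l : List E) :
    pathMon K G x l * vtx K G x = pathMon K G x l := by
  induction l with
  | nil => exact vtx_mul_self x
  | cons e l ih => simp only [pathMon]; rw [mul_assoc, ih]

theorem pathMon_mul_vtx_ne {x y : V} (h : y ≠ x) (l : List E) :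
    pathMon K G x l * vtx K G y = 0 := by
  rw [← pathMon_mul_range, mul_assoc, vtx_mul_ne h.symm, mul_zero]

theorem pathMon_mul_pathMon {x y : V} (l : List E) {m : List E} (h : pathSource G y m = x) :
    pathMon K G x l * pathMon K G y m = pathMon K G y (l ++ m) := by
  induction l with
  | nil => rw [← h]; exact source_mul_pathMon y m
  | cons e l ih => simp only [pathMon, List.cons_append]; rw [mul_assoc, ih]

theorem pathSource_append {x y : V} (l : List E) {m : List E} (h : pathSource G y m = x) :
    pathSource G y (l ++ m) = pathSource G x l := by
  cases l with
  | nil => exact h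
  | cons e l => rfl

theorem IsPath.append {x y : V} {l m : List E} (hl : IsPath G x l) (hm : IsPath G y m)
    (h : pathSource G y m = x) : IsPath G y (l ++ m) := by
  induction l with
  | nil => exact hm
  | cons e l ih => exact ⟨hl.1.trans (pathSource_append l h).symm, ih hl.2⟩

open Classical in
/-- Paths are linearly independent: they have dual linear functionals. -/
theorem exists_dual (x : V) {l : List E} (hl : IsPath G x l) :
    ∃ c : UnitalAlgebra K G →ₗ[K] K, ∀ y m, IsPath G y m →
      c (pathMon K G y m) = if y = x ∧ m = l then 1 else 0 := by
  obtain ⟨σ, ρ, hinj, hv, he⟩ := exists_representation K G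
  let b₀ : ℕ ⊕ E := Sum.inl 0
  let act (m : List E) : ℕ ⊕ E := m.foldr σ b₀
  have hρ : ∀ m, IsPath G x m → ρ (pathMon K G x m) (Finsupp.single (x, b₀, 0) 1) =
      Finsupp.single (pathSource G x m, act m, (m.length : ℤ)) 1 := by
    intro m hm
    induction m with
    | nil => simp [pathMon, hv, pathSource, act]
    | cons e m ih =>
      simp only [pathMon]
      rw [map_mul, Module.End.mul_apply, ih hm.2, ← hm.1, he]
      simp [pathSource, act]
  -- Edges with a common source have disjoint branches, so the first edge can be read off from the
  -- image; the rest follows by induction.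
  have hact : ∀ m l, m.length = l.length → IsPath G x m → IsPath G x l →
      pathSource G x m = pathSource G x l → act m = act l → m = l := by
    intro m
    induction m with
    | nil => intro l h _ _ _ _; exact (List.length_eq_zero_iff.1 h.symm).symm
    | cons e m ih =>
      intro l h hm hl hs ha
      cases l with
      | nil => simp at h
      | cons f l =>
        obtain ⟨rfl, h2⟩ := hinj e f _ _ hs ha
        rw [ih l (by simpa using h) hm.2 hl.2 (hm.1.symm.trans hl.1) h2]
  -- The functional reads one coefficient of the image of the basis vector `(x, b₀, 0)`. The integer
  -- coordinate separates paths of different lengths.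
  refine ⟨(Finsupp.lapply (pathSource G x l, act l, (l.length : ℤ))).comp
    ((LinearMap.applyₗ (Finsupp.single (x, b₀, (0 : ℤ)) (1 : K))).comp ρ.toLinearMap), ?_⟩
  intro y m hm
  change ρ (pathMon K G y m) (Finsupp.single (x, b₀, 0) 1) _ = _
  by_cases hy : y = x
  · subst hy
    rw [hρ m hm, Finsupp.single_apply]
    refine if_congr ⟨fun h => ⟨rfl, ?_⟩, ?_⟩ rfl rfl
    · simp only [Prod.mk.injEq, Nat.cast_inj] at h
      exact hact m l h.2.2 hm hl h.1 h.2.1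
    · rintro ⟨-, rfl⟩; rfl
  · rw [← pathMon_mul_range, map_mul, Module.End.mul_apply, hv,
      if_neg fun h => hy h.symm, if_neg fun h => hy h.1]
    simp

variable (K G) in
/-- The linear span of the paths. -/
noncomputable def realSpan : Submodule K (UnitalAlgebra K G) :=
  Submodule.span K {a | ∃ x l, IsPath G x l ∧ pathMon K G x l = a}

theorem pathMon_mem_realSpan {x : V} {l : List E} (h : IsPath G x l) :
    pathMon K G x l ∈ realSpan K G := Submodule.subset_span ⟨x, l, h, rfl⟩

theorem edg_eq_pathMon (e : E) : edg K G e = pathMon K G (G.r e) [e] := (edg_mul_range e).symm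

theorem isPath_singleton (e : E) : IsPath G (G.r e) [e] := ⟨rfl, trivial⟩

theorem pathMon_ne_zero {x : V} {l : List E} (h : IsPath G x l) : pathMon K G x l ≠ 0 := by
  intro h0
  obtain ⟨c, hc⟩ := exists_dual (K := K) x h
  have := hc x l h
  simp [h0] at this

/-- Only paths with range `x` survive, so the edge list alone can index the coefficients. -/
theorem realSpan_mul_vtx {a : UnitalAlgebra K G} (ha : a ∈ realSpan K G) (x : V) :
    a * vtx K G x ∈ Submodule.span K (Set.range fun l : {l // IsPath G x l} =>
      pathMon K G x l.1) := by
  induction ha using Submodule.span_induction with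
  | mem a ha =>
    obtain ⟨y, l, hl, rfl⟩ := ha
    by_cases h : x = y
    · subst h
      rw [pathMon_mul_range]
      exact Submodule.subset_span ⟨⟨l, hl⟩, rfl⟩
    · rw [pathMon_mul_vtx_ne h]; exact zero_mem _
  | zero => rw [zero_mul]; exact zero_mem _
  | add a b _ _ ha hb => rw [add_mul]; exact add_mem ha hb
  | smul k a _ ha => rw [smul_mul_assoc]; exact Submodule.smul_mem _ k ha

theorem vtx_mul_realSpan {a : UnitalAlgebra K G} (ha : a ∈ realSpan K G) (x : V) :
    vtx K G x * a ∈ Submodule.span K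
      (Set.range fun p : {p : V × List E // IsPath G p.1 p.2 ∧ pathSource G p.1 p.2 = x} =>
        pathMon K G p.1.1 p.1.2) := by
  induction ha using Submodule.span_induction with
  | mem a ha =>
    obtain ⟨y, l, hl, rfl⟩ := ha
    by_cases h : x = pathSource G y l
    · subst h
      rw [source_mul_pathMon]
      exact Submodule.subset_span ⟨⟨(y, l), hl, rfl⟩, rfl⟩
    · rw [vtx_mul_pathMon_ne h]; exact zero_mem _
  | zero => rw [mul_zero]; exact zero_mem _
  | add a b _ _ ha hb => rw [mul_add]; exact add_mem ha hb
  | smul k a _ ha => rw [mul_smul_comm]; exact Submodule.smul_mem _ k ha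

theorem realSpan_mul_vtx_mem {a : UnitalAlgebra K G} (ha : a ∈ realSpan K G) (x : V) :
    a * vtx K G x ∈ realSpan K G := by
  refine Submodule.span_le.2 ?_ (realSpan_mul_vtx ha x)
  rintro _ ⟨l, rfl⟩
  exact pathMon_mem_realSpan l.2

theorem realSpan_mul_pathMon_mem {a : UnitalAlgebra K G} (ha : a ∈ realSpan K G) {x : V}
    {m : List E} (hm : IsPath G x m) : a * pathMon K G x m ∈ realSpan K G := by
  rw [← source_mul_pathMon, ← mul_assoc]
  have h := realSpan_mul_vtx ha (pathSource G x m)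
  generalize a * vtx K G (pathSource G x m) = b at h
  induction h using Submodule.span_induction with
  | mem a ha =>
    obtain ⟨l, rfl⟩ := ha
    simp only
    rw [pathMon_mul_pathMon _ rfl]
    exact pathMon_mem_realSpan (l.2.append hm rfl)
  | zero => rw [zero_mul]; exact zero_mem _
  | add a b _ _ ha hb => rw [add_mul]; exact add_mem ha hb
  | smul k a _ ha => rw [smul_mul_assoc]; exact Submodule.smul_mem _ k ha

theorem realSpan_mul_edg_mem {a : UnitalAlgebra K G} (ha : a ∈ realSpan K G) (e : E) :
    a * edg K G e ∈ realSpan K G := by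
  rw [edg_eq_pathMon]; exact realSpan_mul_pathMon_mem ha (isPath_singleton e)

/-- Path polynomials meeting at a vertex have non-zero product: compare the longest terms. -/
theorem realSpan_mul_ne_zero {q a : UnitalAlgebra K G} {x : V} (hq : q ∈ realSpan K G)
    (ha : a ∈ realSpan K G) (hqx : q * vtx K G x = q) (hax : vtx K G x * a = a)
    (hq0 : q ≠ 0) (ha0 : a ≠ 0) : q * a ≠ 0 := by
  classical
  have hq' := realSpan_mul_vtx hq x
  have ha' := vtx_mul_realSpan ha x
  rw [hqx] at hq'
  rw [hax] at ha'
  obtain ⟨k, rfl⟩ := (Finsupp.mem_span_range_iff_exists_finsupp).1 hq'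
  obtain ⟨c, rfl⟩ := (Finsupp.mem_span_range_iff_exists_finsupp).1 ha'
  have hk : k.support.Nonempty := Finsupp.support_nonempty_iff.2 (by rintro rfl; simp at hq0)
  have hc : c.support.Nonempty := Finsupp.support_nonempty_iff.2 (by rintro rfl; simp at ha0)
  obtain ⟨l₀, hl₀, hlmax⟩ := k.support.exists_max_image (fun l => l.1.length) hk
  obtain ⟨p₀, hp₀, hpmax⟩ := c.support.exists_max_image (fun p => p.1.2.length) hc
  -- The concatenation of two longest terms arises from no other pair: maximality fixes both
  -- lengths, and then the factors agree. Its coefficient in the product is therefore a product of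
  -- two non-zero scalars.
  obtain ⟨d, hd⟩ := exists_dual (K := K) p₀.1.1 (l₀.2.append p₀.2.1 p₀.2.2)
  intro h0
  have h1 := congrArg d h0
  have hterm : ∀ (l : {l // IsPath G x l})
      (p : {p : V × List E // IsPath G p.1 p.2 ∧ pathSource G p.1 p.2 = x}),
      d (pathMon K G x l.1 * pathMon K G p.1.1 p.1.2) =
        if p.1.1 = p₀.1.1 ∧ l.1 ++ p.1.2 = l₀.1 ++ p₀.1.2 then 1 else 0 := by
    intro l p
    rw [pathMon_mul_pathMon _ p.2.2, hd _ _ (l.2.append p.2.1 p.2.2)]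
  simp only [Finsupp.sum, Finset.sum_mul, Finset.mul_sum, smul_mul_smul_comm, map_sum, map_smul,
    hterm, map_zero] at h1
  rw [Finset.sum_comm, Finset.sum_eq_single_of_mem l₀ hl₀, Finset.sum_eq_single_of_mem p₀ hp₀] at h1
  · simp at h1
    exact h1.elim (Finsupp.mem_support_iff.1 hl₀) (Finsupp.mem_support_iff.1 hp₀)
  · intro p hp hne
    rw [if_neg, smul_zero]
    rintro ⟨h2, h3⟩
    exact hne (Subtype.ext (Prod.ext h2 (List.append_cancel_left h3)))
  · intro l hl hne
    refine Finset.sum_eq_zero fun p hp => ?_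
    rw [if_neg, smul_zero]
    rintro ⟨h2, h3⟩
    have h4 := congrArg List.length h3
    simp only [List.length_append] at h4
    have h5 := hlmax l hl
    have h6 := hpmax p hp
    exact hne (Subtype.ext (List.append_inj_left h3 (by omega)))

end Paths

/-! ### Removing ghost edges -/

section Filtration

variable {V : Type u} {E : Type v} {K : Type w} [Field K] {G : DirectedGraph V E}

variable (K G) in
/-- The span of the `α β*` with `α`, `β` paths and `β` of length at most `n`. -/
noncomputable def ghostFiltration : ℕ → Submodule K (UnitalAlgebra K G)
  | 0 => realSpan K G
  | n + 1 => realSpan K G ⊔ Submodule.span K {a | ∃ b ∈ ghostFiltration n, ∃ e, b * gho K G e = a}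

theorem realSpan_le_ghostFiltration (n : ℕ) : realSpan K G ≤ ghostFiltration K G n := by
  cases n with
  | zero => exact le_rfl
  | succ n => exact le_sup_left

theorem mul_gho_mem {n : ℕ} {a : UnitalAlgebra K G} (ha : a ∈ ghostFiltration K G n) (e : E) :
    a * gho K G e ∈ ghostFiltration K G (n + 1) :=
  Submodule.mem_sup_right (Submodule.subset_span ⟨a, ha, e, rfl⟩)

theorem ghostFiltration_mono : Monotone (ghostFiltration K G) := by
  refine monotone_nat_of_le_succ fun n => ?_
  induction n with
  | zero => exact le_sup_left
  | succ n ih =>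
    refine sup_le le_sup_left (Submodule.span_le.2 ?_)
    rintro _ ⟨b, hb, e, rfl⟩
    exact mul_gho_mem (ih hb) e

theorem ghostFiltration_induction {n : ℕ} {p : UnitalAlgebra K G → Prop}
    (real : ∀ a ∈ realSpan K G, p a)
    (ghost : ∀ b ∈ ghostFiltration K G n, ∀ e, p (b * gho K G e))
    (zero : p 0) (add : ∀ a b, p a → p b → p (a + b)) (smul : ∀ (k : K) a, p a → p (k • a))
    {a : UnitalAlgebra K G} (ha : a ∈ ghostFiltration K G (n + 1)) : p a := by
  obtain ⟨b, hb, c, hc, rfl⟩ := Submodule.mem_sup.1 ha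
  refine add _ _ (real b hb) ?_
  clear ha
  induction hc using Submodule.span_induction with
  | mem c hc => obtain ⟨b, hb, e, rfl⟩ := hc; exact ghost b hb e
  | zero => exact zero
  | add c d _ _ hc hd => exact add _ _ hc hd
  | smul k c _ hc => exact smul k _ hc

theorem mul_vtx_mem {n : ℕ} {a : UnitalAlgebra K G} (ha : a ∈ ghostFiltration K G n) (x : V) :
    a * vtx K G x ∈ ghostFiltration K G n := by
  cases n with
  | zero => exact realSpan_mul_vtx_mem ha x
  | succ n =>
    refine ghostFiltration_induction (p := fun a => a * vtx K G x ∈ ghostFiltration K G (n + 1))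
      (fun a ha => realSpan_le_ghostFiltration _ (realSpan_mul_vtx_mem ha x)) (fun b hb e => ?_)
      (by simp) (fun a b ha hb => by rw [add_mul]; exact add_mem ha hb)
      (fun k a ha => by rw [smul_mul_assoc]; exact Submodule.smul_mem _ k ha) ha
    by_cases h : x = G.s e
    · rw [h, mul_assoc, gho_mul_source]; exact mul_gho_mem hb e
    · rw [mul_assoc, gho_mul_vtx_ne h, mul_zero]; exact zero_mem _

/-- The relations `e* e = r(e)` and `f* e = 0` cancel one ghost edge, which drives the induction on
ghost length. -/
theorem mul_edg_mem {n : ℕ} {a : UnitalAlgebra K G} (ha : a ∈ ghostFiltration K G (n + 1))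
    (e : E) : a * edg K G e ∈ ghostFiltration K G n := by
  refine ghostFiltration_induction (p := fun a => a * edg K G e ∈ ghostFiltration K G n)
    (fun a ha => realSpan_le_ghostFiltration _ (realSpan_mul_edg_mem ha e)) (fun b hb f => ?_)
    (by simp) (fun a b ha hb => by rw [add_mul]; exact add_mem ha hb)
    (fun k a ha => by rw [smul_mul_assoc]; exact Submodule.smul_mem _ k ha) ha
  by_cases h : f = e
  · rw [h, mul_assoc, gho_mul_edg]; exact mul_vtx_mem hb _
  · rw [mul_assoc, gho_mul_edg_ne h, mul_zero]; exact zero_mem _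

theorem exists_mem_ghostFiltration {a : UnitalAlgebra K G} (ha : a ∈ LeavittPathAlgebra K G) :
    ∃ n, a ∈ ghostFiltration K G n := by
  -- Stability of the union of the filtration under right multiplication by `a` is added, since the
  -- product case needs it.
  suffices h : (∃ n, a ∈ ghostFiltration K G n) ∧
      ∀ b, (∃ n, b ∈ ghostFiltration K G n) → ∃ n, b * a ∈ ghostFiltration K G n from h.1
  induction ha using NonUnitalAlgebra.adjoin_induction with
  | mem a ha =>
    obtain ⟨x | e | e, rfl⟩ := ha
    · exact ⟨⟨0, pathMon_mem_realSpan (x := x) (l := []) trivial⟩,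
        fun b ⟨n, hb⟩ => ⟨n, mul_vtx_mem hb x⟩⟩
    · refine ⟨⟨0, ?_⟩, fun b ⟨n, hb⟩ => ⟨n, mul_edg_mem (ghostFiltration_mono n.le_succ hb) e⟩⟩
      have := pathMon_mem_realSpan (K := K) (isPath_singleton (G := G) e)
      rwa [← edg_eq_pathMon] at this
    · refine ⟨⟨1, ?_⟩, fun b ⟨n, hb⟩ => ⟨n + 1, mul_gho_mem hb e⟩⟩
      have : vtx K G (G.r e) * gho K G e ∈ ghostFiltration K G 1 :=
        mul_gho_mem (pathMon_mem_realSpan (x := G.r e) (l := []) trivial) e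
      rwa [range_mul_gho] at this
  | add a b _ _ ha hb =>
    have key : ∀ {c d : UnitalAlgebra K G}, (∃ n, c ∈ ghostFiltration K G n) →
        (∃ n, d ∈ ghostFiltration K G n) → ∃ n, c + d ∈ ghostFiltration K G n :=
      fun ⟨m, hm⟩ ⟨n, hn⟩ => ⟨max m n, add_mem (ghostFiltration_mono (le_max_left _ _) hm)
        (ghostFiltration_mono (le_max_right _ _) hn)⟩
    refine ⟨key ha.1 hb.1, fun c hc => ?_⟩
    rw [mul_add]
    exact key (ha.2 c hc) (hb.2 c hc)
  | zero => exact ⟨⟨0, zero_mem _⟩, fun b _ => ⟨0, by simp⟩⟩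
  | mul a b _ _ ha hb =>
    refine ⟨hb.2 a ha.1, fun c hc => ?_⟩
    rw [← mul_assoc]
    exact hb.2 _ (ha.2 c hc)
  | smul k a _ ha =>
    refine ⟨ha.1.imp fun n h => Submodule.smul_mem _ k h, fun c hc => ?_⟩
    rw [mul_smul_comm]
    exact (ha.2 c hc).imp fun n h => Submodule.smul_mem _ k h

/-- Terms are grouped by their last ghost edge. Finiteness of `F` leaves a free edge at any infinite
emitter. -/
theorem exists_decomposition {n : ℕ} {a : UnitalAlgebra K G}
    (ha : a ∈ ghostFiltration K G (n + 1)) : ∃ a₀ ∈ realSpan K G, ∃ (F : Finset E)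
      (c : E → UnitalAlgebra K G), a = a₀ + ∑ e ∈ F, c e * gho K G e := by
  classical
  refine ghostFiltration_induction (p := fun a => ∃ a₀ ∈ realSpan K G, ∃ (F : Finset E)
      (c : E → UnitalAlgebra K G), a = a₀ + ∑ e ∈ F, c e * gho K G e)
    (fun a ha => ⟨a, ha, ∅, 0, by simp⟩) (fun b hb e => ⟨0, zero_mem _, {e}, fun _ => b, by simp⟩)
    ⟨0, zero_mem _, ∅, 0, by simp⟩ ?_ ?_ ha
  · rintro _ _ ⟨a, ha, F, c, rfl⟩ ⟨b, hb, F', c', rfl⟩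
    refine ⟨a + b, add_mem ha hb, F ∪ F',
      fun e => (if e ∈ F then c e else 0) + if e ∈ F' then c' e else 0, ?_⟩
    simp only [add_mul, ite_mul, zero_mul, Finset.sum_add_distrib, Finset.sum_ite_mem,
      Finset.union_inter_cancel_left, Finset.union_inter_cancel_right]
    abel
  · rintro k _ ⟨a, ha, F, c, rfl⟩
    exact ⟨k • a, Submodule.smul_mem _ k ha, F, fun e => k • c e, by
      simp [Finset.smul_sum, smul_add]⟩

/-- An element killed by all edges leaving `x` is real. -/
theorem mem_realSpan_of_mul_edg_eq_zero {n : ℕ} {a : UnitalAlgebra K G} {x : V}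
    (ha : a ∈ ghostFiltration K G (n + 1)) (hax : a * vtx K G x = a)
    (h : ∀ e, G.s e = x → a * edg K G e = 0) : a ∈ realSpan K G := by
  classical
  -- At a regular vertex CK2 gives `a = 0`; at a sink all ghost terms die against `x`; at an
  -- infinite emitter an edge outside `F` isolates the real part.
  by_cases hfin : (G.s ⁻¹' {x}).Finite
  · by_cases hne : (G.s ⁻¹' {x}).Nonempty
    · rw [← hax, vtx_eq_sum x hne hfin, Finset.mul_sum]
      refine Submodule.sum_mem _ fun e he => ?_
      rw [← mul_assoc, h e (by simpa using he), zero_mul]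
      exact zero_mem _
    · obtain ⟨a₀, ha₀, F, c, rfl⟩ := exists_decomposition ha
      rw [← hax, add_mul, Finset.sum_mul, Finset.sum_eq_zero, add_zero]
      · exact realSpan_mul_vtx_mem ha₀ x
      · intro e _
        rw [mul_assoc, gho_mul_vtx_ne fun hx => hne ⟨e, hx.symm⟩, mul_zero]
  · obtain ⟨a₀, ha₀, F, c, rfl⟩ := exists_decomposition ha
    obtain ⟨f, hfx, hfF⟩ := (show (G.s ⁻¹' {x}).Infinite from hfin).exists_notMem_finset F
    have hfx : G.s f = x := hfx
    have hF : ∀ e, (∑ e' ∈ F, c e' * gho K G e') * edg K G e =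
        if e ∈ F then c e * vtx K G (G.r e) else 0 := by
      intro e
      rw [Finset.sum_mul, ← Finset.sum_ite_eq' F e fun e => c e * vtx K G (G.r e)]
      refine Finset.sum_congr rfl fun e' _ => ?_
      split_ifs with h'
      · rw [h', mul_assoc, gho_mul_edg]
      · rw [mul_assoc, gho_mul_edg_ne h', mul_zero]
    -- The edge `f` kills every ghost term, so `a₀ f = a f = 0`, whereas a non-zero `a₀ x` would
    -- have non-zero product with `f`.
    have h0 : a₀ * vtx K G x = 0 := by
      by_contra h0
      refine realSpan_mul_ne_zero (x := x) (realSpan_mul_vtx_mem ha₀ x)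
        (pathMon_mem_realSpan (isPath_singleton f)) ?_ ?_ h0
        (pathMon_ne_zero (isPath_singleton f)) ?_
      · rw [mul_assoc, vtx_mul_self]
      · rw [← edg_eq_pathMon, ← hfx, source_mul_edg]
      · have := h f hfx
        rw [add_mul, hF, if_neg hfF, add_zero] at this
        rw [← edg_eq_pathMon, mul_assoc, ← hfx, source_mul_edg, this]
    rw [← hax, add_mul, h0, zero_add, Finset.sum_mul]
    refine Submodule.sum_mem _ fun e he => ?_
    by_cases hex : x = G.s e
    · have := h e hex.symm
      rw [add_mul, hF, if_pos he] at this
      -- With the real part gone, `a e = 0` reads `c e * r(e) = 0`, so the ghost term of `e`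
      -- vanishes.
      have h1 : a₀ * edg K G e = 0 := by
        rw [← source_mul_edg, ← hex, ← mul_assoc, h0, zero_mul]
      rw [h1, zero_add] at this
      rw [mul_assoc, hex, gho_mul_source, ← range_mul_gho, ← mul_assoc, this, zero_mul]
      exact zero_mem _
    · rw [mul_assoc, gho_mul_vtx_ne hex, mul_zero]; exact zero_mem _

/-- Non-zero elements become non-zero path polynomials after multiplication by a path. -/
theorem exists_mul_pathMon_mem_realSpan {n : ℕ} {a : UnitalAlgebra K G} {x : V}
    (ha : a ∈ ghostFiltration K G n) (hax : a * vtx K G x = a) (h0 : a ≠ 0) :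
    ∃ y l, IsPath G y l ∧ pathSource G y l = x ∧ a * pathMon K G y l ∈ realSpan K G ∧
      a * pathMon K G y l ≠ 0 := by
  induction n generalizing a x with
  | zero =>
    refine ⟨x, [], trivial, rfl, ?_⟩
    change a * vtx K G x ∈ _ ∧ a * vtx K G x ≠ 0
    rw [hax]
    exact ⟨ha, h0⟩
  | succ n ih =>
    by_cases h : ∀ e, G.s e = x → a * edg K G e = 0
    · refine ⟨x, [], trivial, rfl, ?_⟩
      change a * vtx K G x ∈ _ ∧ a * vtx K G x ≠ 0
      rw [hax]
      exact ⟨mem_realSpan_of_mul_edg_eq_zero ha hax h, h0⟩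
    · push Not at h
      obtain ⟨e, hex, he⟩ := h
      obtain ⟨y, l, hl, hs, h1, h2⟩ := ih (a := a * edg K G e) (x := G.r e) (mul_edg_mem ha e)
        (by rw [mul_assoc, edg_mul_range]) he
      rw [mul_assoc] at h1 h2
      exact ⟨y, e :: l, ⟨hs.symm, hl⟩, hex, h1, h2⟩

end Filtration

/-! ### Local units and cancellation in the Leavitt path algebra -/

section Nonsingular

variable {V : Type u} {E : Type v} {K : Type w} [Field K] {G : DirectedGraph V E}

theorem gen_mem (a : Gen V E) : gen K G a ∈ LeavittPathAlgebra K G :=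
  NonUnitalAlgebra.subset_adjoin K ⟨a, rfl⟩

theorem pathMon_mem (x : V) (l : List E) : pathMon K G x l ∈ LeavittPathAlgebra K G := by
  induction l with
  | nil => exact gen_mem _
  | cons e l ih => exact mul_mem (gen_mem (.edge e)) ih

theorem sum_vtx_mem (F : Finset V) : ∑ x ∈ F, vtx K G x ∈ LeavittPathAlgebra K G :=
  sum_mem fun _ _ => gen_mem _

/-- Finite sums of vertices are local units. Quantifying over all larger `F'` lets two elements
share one unit in the additive case. -/
theorem exists_sum_vtx {a : UnitalAlgebra K G} (ha : a ∈ LeavittPathAlgebra K G) :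
    ∃ F : Finset V, ∀ F', F ⊆ F' → a * ∑ x ∈ F', vtx K G x = a := by
  classical
  induction ha using NonUnitalAlgebra.adjoin_induction with
  | mem a ha =>
    have key : ∀ (a : UnitalAlgebra K G) (y : V), a * vtx K G y = a →
        ∃ F : Finset V, ∀ F', F ⊆ F' → a * ∑ x ∈ F', vtx K G x = a := by
      refine fun a y h => ⟨{y}, fun F' hF => ?_⟩
      rw [← h, mul_assoc, Finset.mul_sum, Finset.sum_eq_single y, vtx_mul_self]
      · exact fun x _ hxy => vtx_mul_ne hxy.symm
      · exact fun h => (h (hF (Finset.mem_singleton_self y))).elim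
    obtain ⟨x | e | e, rfl⟩ := ha
    · exact key _ x (vtx_mul_self x)
    · exact key _ _ (edg_mul_range e)
    · exact key _ _ (gho_mul_source e)
  | add a b _ _ ha hb =>
    obtain ⟨F, hF⟩ := ha
    obtain ⟨F', hF'⟩ := hb
    refine ⟨F ∪ F', fun F'' h => ?_⟩
    rw [add_mul, hF _ (Finset.union_subset_left h), hF' _ (Finset.union_subset_right h)]
  | zero => exact ⟨∅, fun _ _ => zero_mul _⟩
  | mul a b _ _ _ hb =>
    obtain ⟨F, hF⟩ := hb
    exact ⟨F, fun F' h => by rw [mul_assoc, hF F' h]⟩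
  | smul k a _ ha =>
    obtain ⟨F, hF⟩ := ha
    exact ⟨F, fun F' h => by rw [smul_mul_assoc, hF F' h]⟩

theorem exists_right_unit (a : LeavittPathAlgebra K G) : ∃ b, a * b = a := by
  obtain ⟨F, hF⟩ := exists_sum_vtx a.2
  exact ⟨⟨_, sum_vtx_mem F⟩, Subtype.ext (hF F subset_rfl)⟩

/-- Every non-zero element acts injectively from the left on some right ideal `p L` on which it
does not vanish. -/
theorem exists_left_injective {a : LeavittPathAlgebra K G} (ha : a ≠ 0) :
    ∃ p, a * p ≠ 0 ∧ ∀ b, a * p * b = 0 → p * b = 0 := by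
  have hx : ∃ x, (a : UnitalAlgebra K G) * vtx K G x ≠ 0 := by
    by_contra! h
    obtain ⟨F, hF⟩ := exists_sum_vtx a.2
    have := hF F subset_rfl
    rw [Finset.mul_sum, Finset.sum_eq_zero fun x _ => h x] at this
    exact ha (Subtype.ext this.symm)
  obtain ⟨x, hx⟩ := hx
  obtain ⟨n, hn⟩ := exists_mem_ghostFiltration a.2
  obtain ⟨y, l, hl, hs, h1, h2⟩ := exists_mul_pathMon_mem_realSpan (mul_vtx_mem hn x)
    (by rw [mul_assoc, vtx_mul_self]) hx
  rw [mul_assoc, ← hs, source_mul_pathMon] at h1 h2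
  refine ⟨⟨pathMon K G y l, pathMon_mem y l⟩, fun h => h2 (congrArg Subtype.val h), fun b h => ?_⟩
  have h : (a : UnitalAlgebra K G) * pathMon K G y l * b = 0 := congrArg Subtype.val h
  refine Subtype.ext ?_
  change pathMon K G y l * (b : UnitalAlgebra K G) = 0
  suffices hb : vtx K G y * (b : UnitalAlgebra K G) = 0 by
    rw [← pathMon_mul_range, mul_assoc, hb, mul_zero]
  by_contra hb
  obtain ⟨F, hF⟩ := exists_sum_vtx b.2
  have hz : ∃ z, vtx K G y * (b : UnitalAlgebra K G) * vtx K G z ≠ 0 := by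
    by_contra! h
    refine hb ?_
    rw [← hF F subset_rfl, ← mul_assoc, Finset.mul_sum, Finset.sum_eq_zero fun z _ => h z]
  obtain ⟨z, hz⟩ := hz
  obtain ⟨m, hm⟩ := exists_mem_ghostFiltration
    (mul_mem (mul_mem (gen_mem (.vertex y)) b.2) (gen_mem (.vertex z)))
  obtain ⟨w, k, -, -, h3, h4⟩ := exists_mul_pathMon_mem_realSpan (x := z) hm
    (by rw [mul_assoc]; exact congrArg _ (vtx_mul_self z)) hz
  -- The path polynomials `a * p` and `y * b * z * k` meet at `y`, yet their product contains `a * p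
  -- * b = 0`.
  refine realSpan_mul_ne_zero (x := y) h1 h3 ?_ ?_ h2 h4 ?_
  · rw [mul_assoc, pathMon_mul_range]
  · simp only [← mul_assoc]
    exact congrArg (· * _ * _ * _) (vtx_mul_self y)
  · change _ * (vtx K G y * (b : UnitalAlgebra K G) * vtx K G z * _) = 0
    simp only [← mul_assoc]
    rw [mul_assoc (a : UnitalAlgebra K G), pathMon_mul_range, h, zero_mul, zero_mul]

theorem exists_anti_involution : ∃ φ : LeavittPathAlgebra K G → LeavittPathAlgebra K G,
    φ 0 = 0 ∧ (∀ a, φ (φ a) = a) ∧ ∀ a b, φ (a * b) = φ b * φ a := by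
  obtain ⟨φ, h1, h2⟩ := exists_involution (K := K) (G := G)
  exact ⟨fun a => ⟨(φ a).unop, h2 a a.2⟩, Subtype.ext (by simp), fun a => Subtype.ext (h1 a),
    fun a b => Subtype.ext (by simp)⟩

theorem exists_left_unit (a : LeavittPathAlgebra K G) : ∃ b, b * a = a := by
  obtain ⟨φ, -, h1, h2⟩ := exists_anti_involution (K := K) (G := G)
  obtain ⟨b, hb⟩ := exists_right_unit (φ a)
  exact ⟨φ b, by rw [← h1 a, ← h2, hb]⟩

/-- The involution carries the left-hand statement for `φ a` to this one. -/
theorem exists_right_injective {a : LeavittPathAlgebra K G} (ha : a ≠ 0) :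
    ∃ p, p * a ≠ 0 ∧ ∀ b, b * (p * a) = 0 → b * p = 0 := by
  obtain ⟨φ, h0, h1, h2⟩ := exists_anti_involution (K := K) (G := G)
  have hinj : ∀ {b}, φ b = 0 → b = 0 := fun {b} h => by rw [← h1 b, h, h0]
  obtain ⟨p, hp, hp'⟩ := exists_left_injective fun h => ha (hinj h)
  refine ⟨φ p, fun h => hp ?_, fun b hb => hinj ?_⟩
  · refine hinj ?_
    rw [h2, h1, h]
  · rw [h2, h1]
    refine hp' _ ?_
    rw [← h0, ← hb, h2, h2, h1]

end Nonsingular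

end LeavittPath

/-! ### Transfer to the endomorphism ring -/

section Endomorphisms

variable {L : Type u} [NonUnitalRing L]

/-- Left multiplication by an element, as an endomorphism of the right regular module. -/
def leftMulEnd (p : L) : rightModuleEnd L :=
  ⟨AddMonoidHom.mulLeft p, fun x y => (mul_assoc p x y).symm⟩

/-- If `x z ≠ 0` and `p` is chosen for `x z`, the left ideal generated by left multiplication by `p`
is non-zero and avoids the annihilator of `x`. -/
theorem isLeftNonsingular_rightModuleEnd
    (left_unit : ∀ a : L, ∃ b, b * a = a)
    (h : ∀ a : L, a ≠ 0 → ∃ p, p * a ≠ 0 ∧ ∀ b, b * (p * a) = 0 → b * p = 0) :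
    IsLeftNonsingular (rightModuleEnd L) := by
  refine (Submodule.eq_bot_iff _).2 fun x hx => ?_
  by_contra hx0
  obtain ⟨z, hz⟩ : ∃ z, x.1 z ≠ 0 := by
    by_contra! h0
    exact hx0 (Subtype.ext (DFunLike.ext _ _ h0))
  obtain ⟨p, hp, hp'⟩ := h _ hz
  refine hx (Submodule.span _ {leftMulEnd p}) ?_ ((Submodule.eq_bot_iff _).2 ?_)
  · intro h0
    have h1 : leftMulEnd p = 0 := Submodule.span_singleton_eq_bot.1 h0
    exact hp (DFunLike.congr_fun (congrArg Subtype.val h1) (x.1 z))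
  · rintro f ⟨hf, hfp⟩
    obtain ⟨a, rfl⟩ := Submodule.mem_span_singleton.1 hfp
    have h1 := DFunLike.congr_fun (congrArg Subtype.val (mem_elementAnnihilator.1 hf)) z
    have h1 : a.1 (p * x.1 z) = 0 := h1
    obtain ⟨u, hu⟩ := left_unit p
    -- With `u p = p`, the endomorphism `a` acts on `p` as left multiplication by `a u`, so
    -- cancellation in `L` applies.
    have h2 : a.1 p = a.1 u * p := by rw [← a.2, hu]
    rw [a.2, h2, mul_assoc] at h1
    have h3 := hp' _ h1
    refine Subtype.ext (DFunLike.ext _ _ fun c => ?_)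
    change a.1 (p * c) = 0
    rw [a.2, h2, h3, zero_mul]

/-- Here the generator is left multiplication by `z * p`: since `x (z p c) = x(z) p c`, cancelling
`x(z)` shows that the ideal avoids the annihilator. -/
theorem isRightNonsingular_rightModuleEnd (right_unit : ∀ a : L, ∃ b, a * b = a)
    (h : ∀ a : L, a ≠ 0 → ∃ p, a * p ≠ 0 ∧ ∀ b, a * p * b = 0 → p * b = 0) :
    IsRightNonsingular (rightModuleEnd L) := by
  refine (Submodule.eq_bot_iff _).2 fun x hx => ?_
  by_contra hx0
  obtain ⟨z, hz⟩ : ∃ z, x.1 z ≠ 0 := by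
    by_contra! h0
    exact hx0 (Subtype.ext (DFunLike.ext _ _ h0))
  obtain ⟨p, hp, hp'⟩ := h _ hz
  let P : Submodule (rightModuleEnd L)ᵐᵒᵖ (rightModuleEnd L)ᵐᵒᵖ :=
    Submodule.span _ {MulOpposite.op (leftMulEnd (z * p))}
  refine hx P ?_ ((Submodule.eq_bot_iff _).2 ?_)
  · intro h0
    have h1 : leftMulEnd (z * p) = 0 :=
      MulOpposite.op_injective (Submodule.span_singleton_eq_bot.1 h0)
    -- Evaluating at a local right unit of `p` recovers `z * p` from its multiplication map.
    obtain ⟨c, hc⟩ := right_unit p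
    have h2 : z * p * c = 0 := DFunLike.congr_fun (congrArg Subtype.val h1) c
    rw [mul_assoc, hc] at h2
    rw [← x.2, h2, map_zero] at hp
    exact hp rfl
  · rintro f ⟨hf, hfp⟩
    obtain ⟨a, rfl⟩ := Submodule.mem_span_singleton.1 hfp
    have h1 : ∀ c, p * a.unop.1 c = 0 := fun c => hp' _ <| by
      have h1 := DFunLike.congr_fun (congrArg Subtype.val (mem_elementAnnihilator.1 hf)) c
      have h1 : x.1 (z * p * a.unop.1 c) = 0 := h1
      rwa [x.2, x.2] at h1
    refine MulOpposite.unop_injective (Subtype.ext (DFunLike.ext _ _ fun c => ?_))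
    change z * p * a.unop.1 c = 0
    rw [mul_assoc, h1, mul_zero]

end Endomorphisms

theorem mainTheorem8 {V : Type u} {E : Type v} {K : Type w} [Field K] (G : DirectedGraph V E) :
    IsLeftNonsingular (rightModuleEnd (LeavittPathAlgebra K G)) ∧
      IsRightNonsingular (rightModuleEnd (LeavittPathAlgebra K G)) :=
  ⟨isLeftNonsingular_rightModuleEnd LeavittPath.exists_left_unit
      fun _ ha => LeavittPath.exists_right_injective ha,
    isRightNonsingular_rightModuleEnd LeavittPath.exists_right_unit
      fun _ ha => LeavittPath.exists_left_injective ha⟩
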